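/- For real $a>0$ and $x\ge 0$ let $$\mathrm{Ci}(a,x)=\int_0^x t^{a-1}\cos t\,dt,\qquad \mathrm{Si}(a,x)=\int_0^x t^{a-1}\sin t\,dt,$$ and, for real $\alpha$, let $\mathrm{Ti}(a,x,\alpha)=\mathrm{Ci}(a,x)\cos(\pi\alpha)+\mathrm{Si}(a,x)\sin(\pi\alpha)$. Define rational functions $F_s^-$ by $$F_0^-(z)=-\frac{z}{(z-1)^2},\qquad F_1^-(z)=-\frac{2z(z+1)}{(z-1)^4},$$ $$F_{s+1}^-(z)=\frac{z}{1-z}\frac{dF_s^-(z)}{dz}-\frac12\sum_{j=0}^{s}F_j^-(z)F_{s-j}^-(z)\qquad(s=1,2,3,\ldots),$$ and, for $z\in\mathbb{C}\setminus[1,\infty)$, let $$E_s^-(z)=\int_0^z\frac{(t-1)F_s^-(t)}{2t}\,dt ,$$ the integral being taken along the straight segment from $0$ to $z$. There exist real-valued functions $\mathcal{E}_R(a,\theta)$ and $\mathcal{E}_I(a,\theta)$ such that, for all real $a>0$ with $a\ne 1$, all real $\theta\ge 0$ and all real $\alpha$, $$\mathrm{Ci}(a,a\theta)=\frac{(a\theta)^a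 e^{\mathcal{E}_R(a,\theta)}}{a\sqrt{\theta^2+1}}\cos\bigl(a\theta-\arctan\theta+\mathcal{E}_I(a,\theta)\bigr),$$ $$\mathrm{Si}(a,a\theta)=\frac{(a\theta)^a e^{\mathcal{E}_R(a,\theta)}}{a\sqrt{\theta^2+1}}\sin\bigl(a\theta-\arctan\theta+\mathcal{E}_I(a,\theta)\bigr),$$ $$\mathrm{Ti}(a,a\theta,\alpha)=\frac{(a\theta)^a e^{\mathcal{E}_R(a,\theta)}}{a\sqrt{\theta^2+1}}\cos\bigl(a\theta-\arctan\theta-\alpha\pi+\mathcal{E}_I(a,\theta)\bigr),$$ and such that, as $a\to\infty$, uniformly for $\theta\in[0,\infty)$, $$\mathcal{E}_R(a,\theta)\sim\sum_{s=1}^\infty(-1)^s\frac{\Re\{E_s^-(-i\theta)\}}{a^s},\qquad \mathcal{E}_I(a,\theta)\sim\sum_{s=1}^\infty(-1)^s\frac{\Im\{E_s^-(-i\theta)\}}{a^s}.$$ That is, for every integer $n\ge 0$ there are constants $C$ and $a_0>0$, depending only on $n$, such that for all $a\ge a_0$ and all $\theta\ge 0$ the difference between each of $\mathcal{E}_R(a,\theta)$,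 $\mathcal{E}_I(a,\theta)$ and the sum of the terms $1\le s\le n-1$ of its series is at most $C/a^n$ in absolute value. -/

import Mathlib

/-- The generalised cosine integral `Ci(a, x) = ∫₀ˣ t^(a-1) cos t dt` (real `a > 0`, `x ≥ 0`). -/
noncomputable def genCi (a x : ℝ) : ℝ := ∫ t in (0 : ℝ)..x, t ^ (a - 1) * Real.cos t

/-- The generalised sine integral `Si(a, x) = ∫₀ˣ t^(a-1) sin t dt` (real `a > 0`, `x ≥ 0`). -/
noncomputable def genSi (a x : ℝ) : ℝ := ∫ t in (0 : ℝ)..x, t ^ (a - 1) * Real.sin t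

/-- The linear combination `Ti(a, x, α) = Ci(a, x) cos(πα) + Si(a, x) sin(πα)`. -/
noncomputable def genTi (a x α : ℝ) : ℝ :=
  genCi a x * Real.cos (Real.pi * α) + genSi a x * Real.sin (Real.pi * α)

/-- The Liouville-Green coefficients `F_s⁻(z)`: `F_0⁻ = -z/(z-1)²`, `F_1⁻ = -2z(z+1)/(z-1)⁴`, and
`F_{s+1}⁻ = z/(1-z) · (F_s⁻)' - (1/2) ∑_{j=0}^{s} F_j⁻ F_{s-j}⁻` for `s ≥ 1`. -/
noncomputable def lgF : ℕ → ℂ → ℂ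
  | 0 => fun z => -z / (z - 1) ^ 2
  | 1 => fun z => -(2 * z * (z + 1)) / (z - 1) ^ 4
  | n + 2 => fun z =>
      z / (1 - z) * deriv (lgF (n + 1)) z
        - 1 / 2 * ∑ j : Fin (n + 2), lgF j z * lgF (n + 1 - j) z
  termination_by s => s
  decreasing_by all_goals omega

/-- The coefficients `E_s⁻(z) = ∫₀ᶻ (t-1) F_s⁻(t) / (2t) dt`, the integral being taken along the
segment `t = u z`, `0 ≤ u ≤ 1` (which avoids the pole `t = 1` when `z ∉ [1, ∞)`). -/
noncomputable def lgE (s : ℕ) (z : ℂ) : ℂ :=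
  ∫ u in (0 : ℝ)..1, z * ((u * z - 1) * lgF s (u * z) / (2 * (u * z)))

/-! ### The coefficients as polynomials in `v = 1 / (1 - z)`, and the formal identity in `1 / a` -/

section LiouvilleGreenPolynomials

open Polynomial

/-! Scaling gives Ci + i Si = (aθ)^a J with J = ∫₀¹ u^(a-1) e^(iaθu) du. Put R = (1 + iθ) a e^(-iaθ)
J (`lgRatio`). The exact formulas are the polar form of R, with principal log R supplying both error
functions. They need only J ≠ 0, which holds for a ≠ 1 by a sign argument (`oscIntegral_ne_zero`).

For the expansion, write v = 1/(1 + iuθ), ε = 1/a and L = ∑_{1≤s<n} (-1)^s E_s ε^s. On the closed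
unit disc, which contains every such v, the F_s and E_s are polynomials in v, so all bounds are
uniform in θ. The u-derivative of u^a e^(iaθu) e^L v is a u^(a-1) e^(iaθu) e^L Q with Q explicit, so
e^L Q = 1 would give R = e^L exactly. The v-derivative of e^L Q is e^L (L'Q + Q'), and the recursion
for F_s says precisely that ε^n divides L'Q + Q' (`exists_lg_defect`). Since e^L Q = 1 at v = 0, it
follows that e^L Q - 1 = O(ε^n |v|). The factor |v| cancels the growth of 1 + iθ on integrating,
whence R = e^L + O(a^(-n)) uniformly, and logarithms are taken. -/

/-- The polynomial expressing `lgF s z` in the variable `v = 1 / (1 - z)`. -/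
noncomputable def lgPoly : ℕ → ℂ[X]
  | 0 => X - X ^ 2
  | 1 => -(2 * X ^ 2 * (X - 1) * (2 * X - 1))
  | n + 2 => X ^ 2 * (X - 1) * derivative (lgPoly (n + 1))
        - C (1 / 2) * ∑ j : Fin (n + 2), lgPoly j * lgPoly (n + 1 - j)
  termination_by s => s
  decreasing_by all_goals omega

theorem hasDerivAt_one_sub_inv {z : ℂ} (hz : z ≠ 1) :
    HasDerivAt (fun w : ℂ => (1 - w)⁻¹) ((1 - z)⁻¹ ^ 2) z := by
  have h : (1 : ℂ) - z ≠ 0 := sub_ne_zero.mpr hz.symm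
  have := ((hasDerivAt_id z).const_sub 1).fun_inv h
  rwa [neg_neg, one_div, ← inv_pow] at this

/-- In the variable v, z/(1-z) is v - 1 and d/dz is v² d/dv, so the operator in the recursion
becomes v²(v-1) d/dv. -/
theorem lgF_eq_eval_lgPoly (s : ℕ) : ∀ z : ℂ, z ≠ 1 → lgF s z = (lgPoly s).eval (1 - z)⁻¹ := by
  induction s using Nat.strong_induction_on with
  | _ s ih =>
    intro z hz
    have h : (1 : ℂ) - z ≠ 0 := sub_ne_zero.mpr hz.symm
    have h' : z - 1 ≠ 0 := sub_ne_zero.mpr hz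
    have e : z - 1 = -(1 - z) := by ring
    match s, ih with
    | 0, _ =>
      simp only [lgF, lgPoly, eval_sub, eval_X, eval_pow]
      rw [e]
      field_simp
      ring
    | 1, _ =>
      simp only [lgF, lgPoly, eval_sub, eval_X, eval_pow, eval_mul, eval_neg, eval_one,
        eval_ofNat]
      rw [e]
      field_simp
      ring
    | n + 2, ih =>
      have hd : deriv (lgF (n + 1)) z =
          (derivative (lgPoly (n + 1))).eval (1 - z)⁻¹ * (1 - z)⁻¹ ^ 2 := by
        have h1 : lgF (n + 1) =ᶠ[nhds z] fun w => (lgPoly (n + 1)).eval (1 - w)⁻¹ := by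
          filter_upwards [isOpen_ne.mem_nhds hz] with w hw
          exact ih (n + 1) (by omega) w hw
        rw [h1.deriv_eq]
        exact (((lgPoly (n + 1)).hasDerivAt _).comp z (hasDerivAt_one_sub_inv hz)).deriv
      have hs : ∀ j : Fin (n + 2), lgF j z * lgF (n + 1 - j) z =
          (lgPoly j * lgPoly (n + 1 - j)).eval (1 - z)⁻¹ := by
        intro j
        rw [ih j (by omega) z hz, ih (n + 1 - j) (by omega) z hz, eval_mul]
      rw [lgF, lgPoly]
      beta_reduce
      rw [hd, Finset.sum_congr rfl fun j _ => hs j]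
      simp only [eval_sub, eval_mul, eval_pow, eval_X, eval_C, eval_finsetSum, eval_one]
      congr 1
      field_simp
      ring

/-- The strong factor makes dE_s/dv = -F_s / (2v²(v-1)) a polynomial. F_0 has only the weak factor,
which is enough for the products in the recursion, each divisible by the square of the weak factor.
-/
theorem X_mul_dvd_lgPoly (s : ℕ) : X * (X - 1) ∣ lgPoly s ∧
    (1 ≤ s → X ^ 2 * (X - 1) ∣ lgPoly s) := by
  induction s using Nat.strong_induction_on with
  | _ s ih =>
    have key : X ^ 2 * (X - 1) ∣ lgPoly s → X * (X - 1) ∣ lgPoly s ∧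
        (1 ≤ s → X ^ 2 * (X - 1) ∣ lgPoly s) := fun h =>
      ⟨(mul_dvd_mul_right (Dvd.intro_left X (by ring)) _).trans h, fun _ => h⟩
    match s, ih with
    | 0, _ => exact ⟨⟨-1, by rw [lgPoly]; ring⟩, by simp⟩
    | 1, _ => exact key ⟨-(2 * (2 * X - 1)), by rw [lgPoly]; ring⟩
    | n + 2, ih =>
      refine key ?_
      rw [lgPoly]
      refine dvd_sub (Dvd.intro _ rfl) (Dvd.dvd.mul_left (Finset.dvd_sum fun j _ => ?_) _)
      have h := mul_dvd_mul (ih j (by omega)).1 (ih (n + 1 - j) (by omega)).1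
      exact (Dvd.intro (X - 1) (by ring)).trans h

theorem exists_antiderivative (p : ℂ[X]) (c : ℂ) :
    ∃ P : ℂ[X], derivative P = p ∧ P.eval c = 0 := by
  suffices h : ∃ P : ℂ[X], derivative P = p by
    obtain ⟨P, hP⟩ := h
    exact ⟨P - C (P.eval c), by simp [hP], by simp⟩
  induction p using Polynomial.induction_on' with
  | add p q hp hq =>
    obtain ⟨P, rfl⟩ := hp
    obtain ⟨Q, rfl⟩ := hq
    exact ⟨P + Q, derivative_add⟩
  | monomial n a =>
    refine ⟨monomial (n + 1) (a / (n + 1)), ?_⟩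
    rw [derivative_monomial]
    have : (n : ℂ) + 1 ≠ 0 := Nat.cast_add_one_ne_zero n
    simp [this]

theorem exists_lgEPoly (s : ℕ) : ∃ e : ℂ[X],
    (1 ≤ s → C 2 * (X ^ 2 * (X - 1)) * derivative e = -lgPoly s) ∧ e.eval 1 = 0 := by
  by_cases hs : 1 ≤ s
  · obtain ⟨p, hp⟩ := (X_mul_dvd_lgPoly s).2 hs
    obtain ⟨e, he, he1⟩ := exists_antiderivative (C (-1 / 2) * p) 1
    refine ⟨e, fun _ => ?_, he1⟩
    rw [he, hp]
    have : (C 2 : ℂ[X]) * C (-1 / 2) = -1 := by rw [← C_mul]; norm_num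
    linear_combination (X ^ 2 * (X - 1)) * p * this
  · exact ⟨0, fun h => absurd h hs, by simp⟩

/-- The polynomial expressing `lgE s z` in the variable `v = 1 / (1 - z)`. -/
noncomputable def lgEPoly (s : ℕ) : ℂ[X] := (exists_lgEPoly s).choose

theorem derivative_lgEPoly {s : ℕ} (hs : 1 ≤ s) :
    C 2 * (X ^ 2 * (X - 1)) * derivative (lgEPoly s) = -lgPoly s :=
  (exists_lgEPoly s).choose_spec.1 hs

theorem eval_one_lgEPoly (s : ℕ) : (lgEPoly s).eval 1 = 0 := (exists_lgEPoly s).choose_spec.2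

theorem one_add_I_mul_ne_zero (x : ℝ) : (1 : ℂ) + Complex.I * x ≠ 0 := by
  intro h
  simpa using congrArg Complex.re h

theorem lgE_eq_eval_lgEPoly {s : ℕ} (hs : 1 ≤ s) (θ : ℝ) :
    lgE s (-(Complex.I * θ)) = (lgEPoly s).eval (1 + Complex.I * θ)⁻¹ := by
  set z : ℂ := -(Complex.I * θ) with hz
  rcases eq_or_ne θ 0 with rfl | hθ
  · simp [hz, lgE, eval_one_lgEPoly]
  have hz0 : z ≠ 0 := by simp [hz, hθ]
  have hne (u : ℝ) : (u : ℂ) * z ≠ 1 := by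
    intro h
    apply one_add_I_mul_ne_zero (u * θ)
    rw [← h, hz]; push_cast; ring
  have hd (u : ℝ) : HasDerivAt (fun u : ℝ => (lgEPoly s).eval (1 - u * z)⁻¹)
      ((derivative (lgEPoly s)).eval (1 - u * z)⁻¹ * ((1 - u * z)⁻¹ ^ 2 * z)) u := by
    have h1 : HasDerivAt (fun u : ℝ => (u : ℂ) * z) z u := by
      simpa using (Complex.ofRealCLM.hasDerivAt (x := u)).mul_const z
    have h2 := (hasDerivAt_one_sub_inv (hne u)).comp u h1
    exact ((lgEPoly s).hasDerivAt _).comp u h2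
  have hc : Continuous fun u : ℝ =>
      (derivative (lgEPoly s)).eval (1 - u * z)⁻¹ * ((1 - u * z)⁻¹ ^ 2 * z) := by
    have : Continuous fun u : ℝ => ((1 : ℂ) - u * z)⁻¹ :=
      Continuous.inv₀ (by fun_prop) fun u => sub_ne_zero.mpr (hne u).symm
    exact ((derivative (lgEPoly s)).continuous.comp this).mul ((this.pow 2).mul continuous_const)
  have hint := intervalIntegral.integral_eq_sub_of_hasDerivAt (a := 0) (b := 1)
    (fun u _ => hd u) (hc.intervalIntegrable _ _)
  have h0 : (lgEPoly s).eval (1 + Complex.I * θ)⁻¹ =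
      (lgEPoly s).eval (1 - (1 : ℝ) * z)⁻¹ - (lgEPoly s).eval (1 - (0 : ℝ) * z)⁻¹ := by
    simp [hz, eval_one_lgEPoly]
  rw [h0, ← hint, lgE]
  -- The point u = 0 is left out: there the integrand of `lgE` is a division by zero with value 0.
  refine intervalIntegral.integral_congr_ae (Filter.Eventually.of_forall fun u hu => ?_)
  have hu0 : (u : ℂ) ≠ 0 := by
    rw [Set.uIoc_of_le zero_le_one] at hu
    exact_mod_cast hu.1.ne'
  rw [lgF_eq_eval_lgPoly s _ (hne u)]
  have hder := congrArg (eval (1 - (u : ℂ) * z)⁻¹) (derivative_lgEPoly hs)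
  have h1 : (1 : ℂ) - u * z ≠ 0 := sub_ne_zero.mpr (hne u).symm
  simp only [eval_sub, eval_mul, eval_pow, eval_X, eval_C, eval_neg, eval_one] at hder
  rw [← neg_eq_iff_eq_neg] at hder
  rw [← hder]
  generalize eval (1 - (u : ℂ) * z)⁻¹ (derivative (lgEPoly s)) = P
  have h2 : (u : ℂ) * z ≠ 0 := mul_ne_zero hu0 hz0
  obtain ⟨w, hw⟩ : ∃ w : ℂ, w = 1 - u * z := ⟨_, rfl⟩
  rw [← hw] at h1 ⊢
  have hw' : (u : ℂ) * z = 1 - w := by rw [hw]; ring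
  rw [hw'] at h2 ⊢
  field_simp
  ring

/-- Truncation of the formal sum `∑ (-1)^s F_s Y^s`, without its constant term. -/
noncomputable def lgS (n : ℕ) : ℂ[X][X] := ∑ s ∈ Finset.Ico 1 n, monomial s ((-1) ^ s * lgPoly s)

/-- The coefficientwise derivative of `lgS`. -/
noncomputable def lgS' (n : ℕ) : ℂ[X][X] :=
  ∑ s ∈ Finset.Ico 1 n, monomial s ((-1) ^ s * derivative (lgPoly s))

/-- Truncation of the formal sum `∑ (-1)^s E_s Y^s`. -/
noncomputable def lgL (n : ℕ) : ℂ[X][X] :=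
  ∑ s ∈ Finset.Ico 1 n, monomial s ((-1) ^ s * lgEPoly s)

/-- The coefficientwise derivative of `lgL`. -/
noncomputable def lgL' (n : ℕ) : ℂ[X][X] :=
  ∑ s ∈ Finset.Ico 1 n, monomial s ((-1) ^ s * derivative (lgEPoly s))

/-- The formal reciprocal of `exp (lgL n)`, up to higher order terms. -/
noncomputable def lgQ (n : ℕ) : ℂ[X][X] :=
  1 - X * C (lgPoly 0) - C (C (1 / 2)) * X * lgS n

/-- The coefficientwise derivative of `lgQ`. -/
noncomputable def lgQ' (n : ℕ) : ℂ[X][X] :=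
  - X * C (derivative (lgPoly 0)) - C (C (1 / 2)) * X * lgS' n

theorem lgL'_mul_weight (n : ℕ) :
    C (X ^ 2 * (X - 1)) * lgL' n = C (C (-1 / 2)) * lgS n := by
  rw [lgL', lgS, Finset.mul_sum, Finset.mul_sum]
  refine Finset.sum_congr rfl fun s hs => ?_
  have h := derivative_lgEPoly (Finset.mem_Ico.mp hs).1
  rw [C_mul_monomial, C_mul_monomial]
  congr 1
  have h2 : (C (-1 / 2) : ℂ[X]) * C 2 = -1 := by rw [← C_mul]; norm_num
  linear_combination -(-1) ^ s * C (-1 / 2) * h +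
    (-1) ^ s * (X ^ 2 * (X - 1) * derivative (lgEPoly s)) * h2

theorem coeff_sum_Ico_monomial (p : ℕ → ℂ[X]) (n k : ℕ) :
    (∑ s ∈ Finset.Ico 1 n, monomial s (p s)).coeff k = if 1 ≤ k ∧ k < n then p k else 0 := by
  simp [coeff_monomial]

theorem lgPoly_succ {k : ℕ} (hk : 1 ≤ k) :
    lgPoly (k + 1) = X ^ 2 * (X - 1) * derivative (lgPoly k) -
      C (1 / 2) * ∑ x ∈ Finset.HasAntidiagonal.antidiagonal k, lgPoly x.1 * lgPoly x.2 := by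
  obtain ⟨m, rfl⟩ := Nat.exists_eq_add_of_le' hk
  rw [lgPoly, Finset.Nat.sum_antidiagonal_eq_sum_range_succ_mk, Finset.sum_range]

/-- The sum `lgS` starts at s = 1, so its square lacks the two end terms F_0 F_k of the full
convolution. -/
theorem coeff_lgS_sq {n k : ℕ} (hk : 1 ≤ k) (hn : k < n) :
    (lgS n * lgS n).coeff k = (-1) ^ k *
      (∑ x ∈ Finset.HasAntidiagonal.antidiagonal k, lgPoly x.1 * lgPoly x.2 - 2 * lgPoly 0 * lgPoly k) := by
  obtain ⟨m, rfl⟩ := Nat.exists_eq_add_of_le' hk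
  rw [coeff_mul, Finset.Nat.sum_antidiagonal_eq_sum_range_succ_mk,
    Finset.Nat.sum_antidiagonal_eq_sum_range_succ_mk, Finset.sum_range_succ, Finset.sum_range_succ',
    Finset.sum_range_succ (fun i => lgPoly i * lgPoly (m + 1 - i)),
    Finset.sum_range_succ' (fun i => lgPoly i * lgPoly (m + 1 - i))]
  have h0 : (lgS n).coeff 0 = 0 := by rw [lgS, coeff_sum_Ico_monomial]; simp
  have hs : ∀ i ∈ Finset.range m, (lgS n).coeff (i + 1) * (lgS n).coeff (m + 1 - (i + 1)) =
      (-1) ^ (m + 1) * (lgPoly (i + 1) * lgPoly (m + 1 - (i + 1))) := by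
    intro i hi
    have hi := Finset.mem_range.mp hi
    rw [lgS, coeff_sum_Ico_monomial, coeff_sum_Ico_monomial, if_pos (by omega), if_pos (by omega),
      show (-1 : ℂ[X]) ^ (m + 1) = (-1) ^ (i + 1) * (-1) ^ (m + 1 - (i + 1)) by
        rw [← pow_add]; congr 1; omega]
    ring
  rw [Finset.sum_congr rfl hs, ← Finset.mul_sum]
  simp only [h0, Nat.sub_self, Nat.sub_zero]
  ring

/-- The left side is the logarithmic-type derivative e^(-L) (e^L Q)'. After multiplication by
v²(v-1), its coefficient of order k + 1 < n is, up to sign, half the recursion defining F_{k+1}. -/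
theorem exists_lg_defect (n : ℕ) :
    ∃ D : ℂ[X][X], lgL' n * lgQ n + lgQ' n = X ^ n * D := by
  rw [← dvd_iff_exists_eq_mul_right, X_pow_dvd_iff]
  intro d hd
  -- The weight turns L' into -S/2, eliminating E_s; it can be cancelled because ℂ[X] is a domain.
  have hw : (X ^ 2 * (X - 1) : ℂ[X]) ≠ 0 :=
    mul_ne_zero (pow_ne_zero _ X_ne_zero) (X_sub_C_ne_zero 1)
  apply (mul_eq_zero.mp _).resolve_left hw
  rw [← coeff_C_mul]
  have hT : C (X ^ 2 * (X - 1)) * (lgL' n * lgQ n + lgQ' n) =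
      C (C (-1 / 2)) * lgS n +
        X * (C (C (1 / 2) * lgPoly 0) * lgS n + C (C (1 / 4)) * (lgS n * lgS n)
          - C (X ^ 2 * (X - 1) * derivative (lgPoly 0))
          - C (X ^ 2 * (X - 1) * C (1 / 2)) * lgS' n) := by
    have h4 : (C (C (1 / 4)) : ℂ[X][X]) = C (C (1 / 2)) * C (C (1 / 2)) := by
      rw [← C_mul, ← C_mul]; norm_num
    have h2 : (C (C (-1 / 2)) : ℂ[X][X]) = -(C (C (1 / 2)) : ℂ[X][X]) := by
      rw [show (-1 / 2 : ℂ) = -(1 / 2) by ring, C_neg, C_neg]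
    have h := lgL'_mul_weight n
    rw [mul_add, ← mul_assoc, h, lgQ, lgQ', h4, h2]
    simp only [C_mul]
    ring
  rw [hT]
  have h4 : (C (1 / 2) : ℂ[X]) = 2 * C (1 / 4) := by
    rw [← C_ofNat, ← C_mul]; norm_num
  have h1 : (1 : ℂ[X]) = 4 * C (1 / 4) := by
    rw [← C_ofNat, ← C_mul]; norm_num
  have h2 : (C (-1 / 2) : ℂ[X]) = - (2 * C (1 / 4)) := by
    rw [← C_ofNat, ← C_mul, ← C_neg]; norm_num
  match d, hd with
  | 0, _ =>
    rw [coeff_add, coeff_C_mul, coeff_X_mul_zero, lgS, coeff_sum_Ico_monomial]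
    simp
  -- Order 1 encodes the separate initial value F_1 = 2v²(v-1) F_0', which does not follow the
  -- general recursion.
  | 1, hd =>
    simp only [coeff_add, coeff_X_mul, coeff_sub, coeff_C_mul, mul_coeff_zero]
    rw [lgS, lgS', coeff_sum_Ico_monomial, coeff_sum_Ico_monomial, coeff_sum_Ico_monomial]
    simp only [coeff_C_zero, lgPoly, derivative_sub, derivative_X, derivative_X_pow]
    rw [if_pos ⟨le_rfl, hd⟩]
    rw [h2]
    simp only [nonpos_iff_eq_zero, Nat.one_ne_zero, false_and, if_false, mul_zero, zero_add, zero_sub,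
      sub_zero, pow_one, Nat.cast_ofNat, Nat.add_one_sub_one, C_ofNat]
    linear_combination (X ^ 2 * (X - 1)) * (2 * X - 1) * h1
  | k + 2, hd =>
    rw [coeff_add, coeff_X_mul, coeff_sub, coeff_sub, coeff_add, coeff_C_mul, coeff_C_mul,
      coeff_C_mul, coeff_C_mul, coeff_lgS_sq (by omega) (by omega), coeff_C_succ]
    rw [lgS, lgS', coeff_sum_Ico_monomial, coeff_sum_Ico_monomial, coeff_sum_Ico_monomial,
      if_pos (by omega), if_pos (by omega), if_pos (by omega), lgPoly_succ (by omega), h2, h4]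
    generalize ∑ x ∈ Finset.HasAntidiagonal.antidiagonal (k + 1), lgPoly x.1 * lgPoly x.2 = A
    linear_combination -(C (1 / 4) * A * (-1) ^ k) * h1

end LiouvilleGreenPolynomials

/-! ### Uniform bounds on the unit disc -/

section LiouvilleGreenBounds

open Polynomial

theorem evalEval_sum_monomial (p : ℕ → ℂ[X]) (t : Finset ℕ) (v ε : ℂ) :
    (∑ s ∈ t, monomial s (p s)).evalEval v ε = ∑ s ∈ t, (p s).eval v * ε ^ s := by
  rw [evalEval_finsetSum]
  refine Finset.sum_congr rfl fun s _ => ?_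
  rw [evalEval, eval_monomial, eval_mul, eval_pow, eval_C]

theorem hasDerivAt_evalEval_sum_monomial (p : ℕ → ℂ[X]) (t : Finset ℕ) (v ε : ℂ) :
    HasDerivAt (fun v => (∑ s ∈ t, monomial s ((-1) ^ s * p s)).evalEval v ε)
      ((∑ s ∈ t, monomial s ((-1) ^ s * derivative (p s))).evalEval v ε) v := by
  simp only [evalEval_sum_monomial]
  refine HasDerivAt.fun_sum fun s _ => HasDerivAt.mul_const ?_ _
  simpa using ((p s).hasDerivAt v).const_mul ((-1) ^ s)

theorem hasDerivAt_lgL (n : ℕ) (v ε : ℂ) :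
    HasDerivAt (fun v => (lgL n).evalEval v ε) ((lgL' n).evalEval v ε) v :=
  hasDerivAt_evalEval_sum_monomial lgEPoly _ v ε

theorem evalEval_lgQ (n : ℕ) (v ε : ℂ) : (lgQ n).evalEval v ε =
    1 - ε * (lgPoly 0).eval v - 1 / 2 * ε * (lgS n).evalEval v ε := by
  simp [lgQ, evalEval_C]
  ring

theorem evalEval_lgQ' (n : ℕ) (v ε : ℂ) : (lgQ' n).evalEval v ε =
    -(ε * (derivative (lgPoly 0)).eval v) - 1 / 2 * ε * (lgS' n).evalEval v ε := by
  simp [lgQ', evalEval_C]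

theorem hasDerivAt_lgQ (n : ℕ) (v ε : ℂ) :
    HasDerivAt (fun v => (lgQ n).evalEval v ε) ((lgQ' n).evalEval v ε) v := by
  simp only [evalEval_lgQ, evalEval_lgQ']
  have hS : HasDerivAt (fun v => (lgS n).evalEval v ε) ((lgS' n).evalEval v ε) v :=
    hasDerivAt_evalEval_sum_monomial lgPoly _ v ε
  have h := ((((lgPoly 0).hasDerivAt v).const_mul ε).const_sub 1).sub (hS.const_mul (1 / 2 * ε))
  exact h

theorem evalEval_lgQ_eq (n : ℕ) (v ε : ℂ) : (lgQ n).evalEval v ε =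
    1 - ε * (v - v ^ 2) + ε * (v ^ 2 * (v - 1) * (lgL' n).evalEval v ε) := by
  have h := congrArg (evalEval v ε) (lgL'_mul_weight n)
  simp only [evalEval_mul, evalEval_C, eval_mul, eval_pow, eval_sub, eval_X, eval_one, eval_C] at h
  rw [evalEval_lgQ, h, lgPoly]
  simp only [eval_sub, eval_pow, eval_X]
  ring

theorem evalEval_lgL_one (n : ℕ) (ε : ℂ) : (lgL n).evalEval 1 ε = 0 := by
  simp [lgL, evalEval_sum_monomial, eval_one_lgEPoly]

theorem evalEval_lgQ_zero (n : ℕ) (ε : ℂ) : (lgQ n).evalEval 0 ε = 1 := by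
  rw [evalEval_lgQ_eq]; simp

theorem evalEval_lgQ_one (n : ℕ) (ε : ℂ) : (lgQ n).evalEval 1 ε = 1 := by
  rw [evalEval_lgQ_eq]; simp

theorem exists_norm_evalEval_le (D : ℂ[X][X]) :
    ∃ C : ℝ, 0 ≤ C ∧ ∀ v ε : ℂ, ‖v‖ ≤ 1 → ‖ε‖ ≤ 1 → ‖D.evalEval v ε‖ ≤ C := by
  have hcont : Continuous fun p : ℂ × ℂ => D.evalEval p.1 p.2 := by
    have : ∀ p : ℂ × ℂ, D.evalEval p.1 p.2 =
        ∑ i ∈ Finset.range (D.natDegree + 1), (D.coeff i).eval p.1 * p.2 ^ i := by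
      intro p
      rw [evalEval, eval_eq_sum_range (p := D), eval_finsetSum]
      simp
    simp only [this]
    exact continuous_finsetSum _ fun i _ =>
      ((D.coeff i).continuous.comp continuous_fst).mul (continuous_snd.pow i)
  obtain ⟨C, hC⟩ := ((isCompact_closedBall (0 : ℂ) 1).prod
    (isCompact_closedBall (0 : ℂ) 1)).exists_bound_of_continuousOn hcont.continuousOn
  refine ⟨max C 0, le_max_right _ _, fun v ε hv hε => (hC (v, ε) ?_).trans (le_max_left _ _)⟩
  simpa using ⟨hv, hε⟩

theorem exists_norm_lgL_le (n : ℕ) : ∃ C : ℝ, 0 ≤ C ∧ ∀ v ε : ℂ, ‖v‖ ≤ 1 → ‖ε‖ ≤ 1 →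
    ‖(lgL n).evalEval v ε‖ ≤ C * ‖ε‖ := by
  have h : X ∣ lgL n := by
    rw [X_dvd_iff, lgL, coeff_sum_Ico_monomial]
    simp
  obtain ⟨D, hD⟩ := h
  obtain ⟨C, hC, hb⟩ := exists_norm_evalEval_le D
  refine ⟨C, hC, fun v ε hv hε => ?_⟩
  rw [hD, evalEval_mul, evalEval_X, norm_mul, mul_comm]
  gcongr
  exact hb v ε hv hε

/-- Mean value inequality on the convex disc: the derivative e^L (L'Q + Q') carries the factor ε^n.
-/
theorem exists_norm_defect_sub_le (n : ℕ) : ∃ C : ℝ, 0 ≤ C ∧ ∀ v w ε : ℂ, ‖v‖ ≤ 1 → ‖w‖ ≤ 1 →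
    ‖ε‖ ≤ 1 →
    ‖Complex.exp ((lgL n).evalEval v ε) * (lgQ n).evalEval v ε -
      Complex.exp ((lgL n).evalEval w ε) * (lgQ n).evalEval w ε‖ ≤ C * ‖ε‖ ^ n * ‖v - w‖ := by
  obtain ⟨D, hD⟩ := exists_lg_defect n
  obtain ⟨C, hC, hb⟩ := exists_norm_evalEval_le D
  obtain ⟨B, hB, hL⟩ := exists_norm_evalEval_le (lgL n)
  refine ⟨Real.exp B * C, by positivity, fun v w ε hv hw hε => ?_⟩
  have hder (x : ℂ) : HasDerivAt
      (fun v => Complex.exp ((lgL n).evalEval v ε) * (lgQ n).evalEval v ε)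
      (Complex.exp ((lgL n).evalEval x ε) * (ε ^ n * D.evalEval x ε)) x := by
    have h := ((hasDerivAt_lgL n x ε).cexp).mul (hasDerivAt_lgQ n x ε)
    have hD' := congrArg (evalEval x ε) hD
    simp only [evalEval_mul, evalEval_add, evalEval_pow, evalEval_X] at hD'
    refine h.congr_deriv ?_
    rw [← hD']
    ring
  refine (convex_closedBall (0 : ℂ) 1).norm_image_sub_le_of_norm_hasDerivWithin_le
    (fun x _ => (hder x).hasDerivWithinAt) (fun x hx => ?_) (by simpa using hw) (by simpa using hv)
  have hx : ‖x‖ ≤ 1 := by simpa using hx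
  rw [norm_mul, norm_mul, norm_pow, mul_assoc, mul_comm C]
  gcongr
  · exact (Complex.norm_exp_le_exp_norm _).trans (Real.exp_le_exp.mpr (hL x ε hx hε))
  · exact hb x ε hx hε

/-- E_s is normalised at v = 1 (z = 0), yet it also vanishes at v = 0 (z = ∞). By induction e^L Q
equals exp(c ε^s) at v = 0, with c = ±E_s, and equals 1 at v = 1. These differ by O(ε^(s+1)), which
forces c = 0. -/
theorem eval_zero_lgEPoly {s : ℕ} (hs : 1 ≤ s) : (lgEPoly s).eval 0 = 0 := by
  induction s using Nat.strong_induction_on with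
  | _ s ih =>
    obtain ⟨C, hC, hb⟩ := exists_norm_defect_sub_le (s + 1)
    set c : ℂ := (-1) ^ s * (lgEPoly s).eval 0 with hc
    have hL (ε : ℂ) : (lgL (s + 1)).evalEval 0 ε = c * ε ^ s := by
      rw [lgL, evalEval_sum_monomial, Finset.sum_Ico_succ_top hs, Finset.sum_eq_zero, zero_add]
      · simp [hc]
      · intro i hi
        have hi := Finset.mem_Ico.mp hi
        simp [ih i hi.2 hi.1]
    have key (ε : ℝ) (h0 : 0 < ε) (h1 : ε ≤ 1) (hcε : ‖c‖ * ε ≤ 1) :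
        ‖c‖ ≤ (C + ‖c‖ ^ 2) * ε := by
      have hn : ‖(ε : ℂ)‖ = ε := by simp [h0.le]
      have h := hb 0 1 ε (by simp) (by simp) (by rw [hn]; exact h1)
      rw [hL, evalEval_lgQ_zero, evalEval_lgQ_one, evalEval_lgL_one, Complex.exp_zero, hn] at h
      simp only [mul_one, zero_sub, norm_neg, norm_one] at h
      have hp : ε ^ s ≤ ε := pow_le_of_le_one h0.le h1 (by omega)
      have hw : ‖c * (ε : ℂ) ^ s‖ = ‖c‖ * ε ^ s := by rw [norm_mul, norm_pow, hn]
      have h2 := Complex.norm_exp_sub_one_sub_id_le (x := c * (ε : ℂ) ^ s)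
        (by rw [hw]; exact (mul_le_mul_of_nonneg_left hp (norm_nonneg _)).trans hcε)
      have h3 := norm_sub_le (Complex.exp (c * (ε : ℂ) ^ s) - 1)
        (Complex.exp (c * (ε : ℂ) ^ s) - 1 - c * (ε : ℂ) ^ s)
      rw [sub_sub_cancel] at h3
      rw [hw] at h2 h3
      have hpos : 0 < ε ^ s := pow_pos h0 s
      have h4 : (‖c‖ * ε ^ s) ^ 2 ≤ ‖c‖ ^ 2 * ε * ε ^ s := by
        rw [mul_pow, sq (ε ^ s), mul_assoc]
        gcongr
      have h5 : ‖c‖ * ε ^ s ≤ (C + ‖c‖ ^ 2) * ε * ε ^ s := by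
        rw [pow_succ] at h
        linarith
      exact le_of_mul_le_mul_right h5 hpos
    have hc0 : c = 0 := by
      by_contra hne
      have hcp : 0 < ‖c‖ := norm_pos_iff.mpr hne
      set K := C + ‖c‖ ^ 2 + ‖c‖ + 1 with hK
      have hKpos : 0 < K := by positivity
      have hcpos := sq_nonneg ‖c‖
      -- Small enough for both side conditions of `key`, and δK ≤ ‖c‖/2 contradicts its conclusion.
      set δ := min 1 ‖c‖ / (2 * K) with hδ
      have hm : 0 < min 1 ‖c‖ := lt_min one_pos hcp
      have hδK : δ * K = min 1 ‖c‖ / 2 := by rw [hδ]; field_simp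
      have hδ0 : 0 < δ := by positivity
      have hm1 := min_le_left 1 ‖c‖
      have hm2 := min_le_right 1 ‖c‖
      have h1 : δ ≤ 1 := by nlinarith
      have h2 : ‖c‖ * δ ≤ 1 := by nlinarith
      have := key δ hδ0 h1 h2
      nlinarith
    have := hc0
    rw [hc] at this
    exact (mul_eq_zero.mp this).resolve_left (pow_ne_zero _ (by norm_num))

theorem exists_norm_defect_le (n : ℕ) : ∃ C : ℝ, 0 ≤ C ∧ ∀ v ε : ℂ, ‖v‖ ≤ 1 → ‖ε‖ ≤ 1 →
    ‖Complex.exp ((lgL n).evalEval v ε) * (lgQ n).evalEval v ε - 1‖ ≤ C * ‖ε‖ ^ n * ‖v‖ := by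
  obtain ⟨C, hC, hb⟩ := exists_norm_defect_sub_le n
  refine ⟨C, hC, fun v ε hv hε => ?_⟩
  have h := hb v 0 ε hv (by simp) hε
  have hL : (lgL n).evalEval 0 ε = 0 := by
    rw [lgL, evalEval_sum_monomial]
    refine Finset.sum_eq_zero fun s hs => ?_
    simp [eval_zero_lgEPoly (Finset.mem_Ico.mp hs).1]
  rwa [hL, evalEval_lgQ_zero, Complex.exp_zero, one_mul, sub_zero] at h

end LiouvilleGreenBounds

/-! ### Nonvanishing of the oscillatory integral -/

section Nonvanishing

theorem one_sub_cos_eq_sinc_sq (x : ℝ) :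
    1 - Real.cos x = x ^ 2 / 2 * Real.sinc (x / 2) ^ 2 := by
  have h : 1 - Real.cos x = 2 * Real.sin (x / 2) ^ 2 := by
    rw [Real.sin_sq_eq_half_sub, show 2 * (x / 2) = x by ring]; ring
  rcases eq_or_ne x 0 with rfl | hx
  · simp
  · rw [h, Real.sinc_of_ne_zero (by positivity)]
    field_simp

/-- The integrand is nonnegative, and strictly positive as long as 0 < cu ≤ 1. -/
theorem integral_one_sub_cos_mul_pos {w : ℝ → ℝ} {c : ℝ} (hc : 0 < c)
    (hw : ∀ u ∈ Set.Ioo (0 : ℝ) 1, 0 < w u)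
    {g : ℝ → ℝ} (hg : ∀ u ∈ Set.Ioo (0 : ℝ) 1, g u = w u * (1 - Real.cos (c * u)))
    (hnn : ∀ u ∈ Set.Icc (0 : ℝ) 1, 0 ≤ g u)
    (hi : IntervalIntegrable g MeasureTheory.volume 0 1) :
    0 < ∫ u in (0 : ℝ)..1, g u := by
  set δ := min 1 c⁻¹ with hδ
  have hδ0 : 0 < δ := lt_min one_pos (inv_pos.mpr hc)
  have hδ1 : δ ≤ 1 := min_le_left _ _
  have hcδ : c * δ ≤ 1 := by
    calc c * δ ≤ c * c⁻¹ := by gcongr; exact min_le_right _ _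
      _ = 1 := mul_inv_cancel₀ hc.ne'
  have hi1 : IntervalIntegrable g MeasureTheory.volume 0 δ := hi.mono_set (by
    rw [Set.uIcc_of_le hδ0.le, Set.uIcc_of_le zero_le_one]; exact Set.Icc_subset_Icc_right hδ1)
  have hi2 : IntervalIntegrable g MeasureTheory.volume δ 1 := hi.mono_set (by
    rw [Set.uIcc_of_le hδ1, Set.uIcc_of_le zero_le_one]; exact Set.Icc_subset_Icc_left hδ0.le)
  rw [← intervalIntegral.integral_add_adjacent_intervals hi1 hi2]
  refine add_pos_of_pos_of_nonneg
    (intervalIntegral.intervalIntegral_pos_of_pos_on hi1 (fun u hu => ?_) hδ0)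
    (intervalIntegral.integral_nonneg hδ1 fun u hu => hnn u ⟨hδ0.le.trans hu.1, hu.2⟩)
  have hu' : u ∈ Set.Ioo (0 : ℝ) 1 := ⟨hu.1, hu.2.trans_le hδ1⟩
  rw [hg u hu']
  refine mul_pos (hw u hu') (sub_pos.mpr ?_)
  have hcu : c * u ≤ 1 := (mul_le_mul_of_nonneg_left hu.2.le hc.le).trans hcδ
  rw [← Real.cos_zero]
  exact Real.cos_lt_cos_of_nonneg_of_le_pi le_rfl (by linarith [Real.pi_gt_three])
    (mul_pos hc hu.1)

/-- Integrate by parts with the primitive 1 - cos(cu) ≥ 0: the boundary term is nonnegative and the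
remaining integral has the positive factor 1 - a. Writing 1 - cos through `sinc` removes the
singularity at u = 0. -/
theorem integral_rpow_mul_sin_pos {a c : ℝ} (ha : 0 < a) (ha1 : a < 1) (hc : 0 < c) :
    0 < ∫ u in (0 : ℝ)..1, u ^ (a - 1) * Real.sin (c * u) := by
  have hder (u : ℝ) (hu : u ∈ Set.Ioo (0 : ℝ) 1) :
      HasDerivAt (fun u : ℝ => u ^ (a + 1) * (c ^ 2 / 2 * Real.sinc (c * u / 2) ^ 2))
      (c * (u ^ (a - 1) * Real.sin (c * u)) -
        (1 - a) * (u ^ a * (c ^ 2 / 2 * Real.sinc (c * u / 2) ^ 2))) u := by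
    have h0 : u ≠ 0 := hu.1.ne'
    have h1 : HasDerivAt (fun u : ℝ => u ^ (a - 1) * (1 - Real.cos (c * u)))
        ((a - 1) * u ^ (a - 1 - 1) * (1 - Real.cos (c * u)) +
          u ^ (a - 1) * (c * Real.sin (c * u))) u := by
      have h2 : HasDerivAt (fun u : ℝ => c * u) c u := by
        simpa using (hasDerivAt_id u).const_mul c
      have h3 := (h2.cos).const_sub 1
      have h4 := (Real.hasDerivAt_rpow_const (p := a - 1) (Or.inl h0)).mul h3
      exact h4.congr_deriv (by ring)
    have h5 := h1.congr_of_eventuallyEq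
      (f₁ := fun u : ℝ => u ^ (a + 1) * (c ^ 2 / 2 * Real.sinc (c * u / 2) ^ 2)) (by
        filter_upwards [isOpen_Ioi.mem_nhds hu.1] with t ht
        rw [one_sub_cos_eq_sinc_sq, show a + 1 = a - 1 + 2 by ring, Real.rpow_add ht,
          Real.rpow_two]
        ring)
    refine h5.congr_deriv ?_
    rw [one_sub_cos_eq_sinc_sq, show a = a - 1 - 1 + 2 by ring, Real.rpow_add hu.1,
      Real.rpow_two, show a - 1 - 1 + 2 = a by ring]
    ring
  have hcs : Continuous fun u : ℝ => c ^ 2 / 2 * Real.sinc (c * u / 2) ^ 2 :=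
    continuous_const.mul ((Real.continuous_sinc.comp (by fun_prop)).pow 2)
  have hcont (p : ℝ) (hp : 0 < p) :
      Continuous fun u : ℝ => u ^ p * (c ^ 2 / 2 * Real.sinc (c * u / 2) ^ 2) :=
    (Real.continuous_rpow_const hp.le).mul hcs
  have hi1 : IntervalIntegrable (fun u : ℝ => u ^ (a - 1) * Real.sin (c * u))
      MeasureTheory.volume 0 1 :=
    (intervalIntegral.intervalIntegrable_rpow' (by linarith)).mul_continuousOn
      (by fun_prop)
  have hi2 := (hcont a ha).intervalIntegrable (μ := MeasureTheory.volume) 0 1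
  have hftc := intervalIntegral.integral_eq_sub_of_hasDerivAt_of_le zero_le_one
    (hcont (a + 1) (by linarith)).continuousOn hder
    ((hi1.const_mul c).sub (hi2.const_mul (1 - a)))
  rw [intervalIntegral.integral_sub (hi1.const_mul c) (hi2.const_mul (1 - a)),
    intervalIntegral.integral_const_mul, intervalIntegral.integral_const_mul,
    Real.zero_rpow (by linarith), Real.one_rpow, zero_mul, sub_zero, one_mul] at hftc
  have hpos : 0 < ∫ u in (0 : ℝ)..1, u ^ a * (c ^ 2 / 2 * Real.sinc (c * u / 2) ^ 2) := by
    refine integral_one_sub_cos_mul_pos (w := fun u => u ^ (a - 2)) hc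
      (fun u hu => Real.rpow_pos_of_pos hu.1 _) (fun u hu => ?_)
      (fun u hu => mul_nonneg (Real.rpow_nonneg hu.1 _) (by positivity)) hi2
    rw [one_sub_cos_eq_sinc_sq, show a = a - 2 + 2 by ring, Real.rpow_add hu.1,
      Real.rpow_two, show a - 2 + 2 = a by ring]
    ring
  have h6 : 0 ≤ c ^ 2 / 2 * Real.sinc (c * 1 / 2) ^ 2 := by positivity
  have h7 := mul_pos (sub_pos.mpr ha1) hpos
  have h8 : 0 < c * ∫ u in (0 : ℝ)..1, u ^ (a - 1) * Real.sin (c * u) := by linarith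
  exact pos_of_mul_pos_right h8 hc.le

/-- Here u^(a-1) (1 - cos(c(1-u))) vanishes at both ends, so integration by parts leaves a positive
multiple of a - 1. -/
theorem integral_rpow_mul_sin_one_sub_pos {a c : ℝ} (ha : 1 < a) (hc : 0 < c) :
    0 < ∫ u in (0 : ℝ)..1, u ^ (a - 1) * Real.sin (c * (1 - u)) := by
  have hder (u : ℝ) (hu : u ∈ Set.Ioo (0 : ℝ) 1) :
      HasDerivAt (fun u : ℝ => u ^ (a - 1) * (1 - Real.cos (c * (1 - u))))
        ((a - 1) * (u ^ (a - 2) * (1 - Real.cos (c * (1 - u)))) -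
          c * (u ^ (a - 1) * Real.sin (c * (1 - u)))) u := by
    have h2 : HasDerivAt (fun u : ℝ => c * (1 - u)) (-c) u := by
      simpa using ((hasDerivAt_id u).const_sub 1).const_mul c
    have h4 := (Real.hasDerivAt_rpow_const (p := a - 1) (Or.inl hu.1.ne')).mul (h2.cos.const_sub 1)
    refine h4.congr_deriv ?_
    rw [show a - 1 - 1 = a - 2 by ring]
    ring
  have hcont : Continuous fun u : ℝ => u ^ (a - 1) * (1 - Real.cos (c * (1 - u))) :=
    (Real.continuous_rpow_const (by linarith)).mul (by fun_prop)
  have hi1 : IntervalIntegrable (fun u : ℝ => u ^ (a - 1) * Real.sin (c * (1 - u)))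
      MeasureTheory.volume 0 1 :=
    (intervalIntegral.intervalIntegrable_rpow' (by linarith)).mul_continuousOn (by fun_prop)
  have hi2 : IntervalIntegrable (fun u : ℝ => u ^ (a - 2) * (1 - Real.cos (c * (1 - u))))
      MeasureTheory.volume 0 1 :=
    (intervalIntegral.intervalIntegrable_rpow' (by linarith)).mul_continuousOn (by fun_prop)
  have hftc := intervalIntegral.integral_eq_sub_of_hasDerivAt_of_le zero_le_one
    hcont.continuousOn hder ((hi2.const_mul (a - 1)).sub (hi1.const_mul c))
  rw [intervalIntegral.integral_sub (hi2.const_mul (a - 1)) (hi1.const_mul c),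
    intervalIntegral.integral_const_mul, intervalIntegral.integral_const_mul,
    Real.zero_rpow (by linarith), sub_self, mul_zero, Real.cos_zero, sub_self, mul_zero] at hftc
  have hpos : 0 < ∫ u in (0 : ℝ)..1, u ^ (a - 2) * (1 - Real.cos (c * (1 - u))) := by
    have h := intervalIntegral.integral_comp_sub_left
      (fun u : ℝ => u ^ (a - 2) * (1 - Real.cos (c * (1 - u)))) (a := 0) (b := 1) 1
    simp only [sub_zero, sub_self] at h
    rw [← h]
    have hi3 := hi2.comp_sub_left 1
    simp only [sub_zero, sub_self] at hi3
    refine integral_one_sub_cos_mul_pos (w := fun u => (1 - u) ^ (a - 2)) hc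
      (fun u hu => Real.rpow_pos_of_pos (by linarith [hu.2]) _) (fun u hu => ?_)
      (fun u hu => mul_nonneg (Real.rpow_nonneg (by linarith [hu.2]) _)
        (sub_nonneg.mpr (Real.cos_le_one _))) hi3.symm
    simp
  have h7 := mul_pos (sub_pos.mpr ha) hpos
  have h8 : 0 < c * ∫ u in (0 : ℝ)..1, u ^ (a - 1) * Real.sin (c * (1 - u)) := by linarith
  exact pos_of_mul_pos_right h8 hc.le

/-- The integral `∫₀¹ u^(a-1) e^(icu) du`. -/
noncomputable def oscIntegral (a c : ℝ) : ℂ :=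
  ∫ u in (0 : ℝ)..1, ((u ^ (a - 1) : ℝ) : ℂ) * Complex.exp (Complex.I * (c * u))

theorem intervalIntegrable_ofReal {f : ℝ → ℝ} {a b : ℝ}
    (hf : IntervalIntegrable f MeasureTheory.volume a b) :
    IntervalIntegrable (fun u => (f u : ℂ)) MeasureTheory.volume a b :=
  ⟨hf.1.ofReal, hf.2.ofReal⟩

theorem exp_I_mul_ofReal (x : ℝ) :
    Complex.exp (Complex.I * x) = Real.cos x + Real.sin x * Complex.I := by
  rw [mul_comm, Complex.exp_mul_I, Complex.ofReal_cos, Complex.ofReal_sin]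

theorem integral_rpow_mul_exp_eq {a : ℝ} (ha : 0 < a) (x : ℝ) {f : ℝ → ℝ} (hf : Continuous f) :
    ∫ u in (0 : ℝ)..x, ((u ^ (a - 1) : ℝ) : ℂ) * Complex.exp (Complex.I * (f u : ℝ)) =
      ((∫ u in (0 : ℝ)..x, u ^ (a - 1) * Real.cos (f u) : ℝ) : ℂ) +
      ((∫ u in (0 : ℝ)..x, u ^ (a - 1) * Real.sin (f u) : ℝ) : ℂ) * Complex.I := by
  have hr : IntervalIntegrable (fun u : ℝ => u ^ (a - 1)) MeasureTheory.volume 0 x :=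
    intervalIntegral.intervalIntegrable_rpow' (by linarith)
  have h1 : IntervalIntegrable (fun u : ℝ => u ^ (a - 1) * Real.cos (f u))
    MeasureTheory.volume 0 x := hr.mul_continuousOn (by fun_prop)
  have h2 : IntervalIntegrable (fun u : ℝ => u ^ (a - 1) * Real.sin (f u))
    MeasureTheory.volume 0 x := hr.mul_continuousOn (by fun_prop)
  rw [← intervalIntegral.integral_ofReal, ← intervalIntegral.integral_ofReal,
    ← intervalIntegral.integral_mul_const,
    ← intervalIntegral.integral_add (intervalIntegrable_ofReal h1)
      ((intervalIntegrable_ofReal h2).mul_const _)]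
  refine intervalIntegral.integral_congr fun u _ => ?_
  simp only [exp_I_mul_ofReal]
  push_cast
  ring

/-- For c > 0 an imaginary part is positive: that of the integral if a < 1, that of e^(-ic) times it
if a > 1. For a = 1 it vanishes at nonzero multiples of 2π. -/
theorem oscIntegral_ne_zero {a c : ℝ} (ha : 0 < a) (ha1 : a ≠ 1) (hc : 0 ≤ c) :
    oscIntegral a c ≠ 0 := by
  intro h
  rcases hc.eq_or_lt with rfl | hc
  · have h1 := integral_rpow_mul_exp_eq ha 1 (f := fun u => 0 * u) (by fun_prop)
    rw [oscIntegral] at h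
    push_cast at h1 h
    rw [h] at h1
    simp only [zero_mul, Real.cos_zero, Real.sin_zero, mul_one, mul_zero,
      intervalIntegral.integral_zero, integral_rpow (Or.inl (show -1 < a - 1 by linarith))] at h1
    norm_num [Real.zero_rpow ha.ne'] at h1
    exact ha.ne (by exact_mod_cast h1)
  rcases ha1.lt_or_gt with h1 | h1
  · have h2 := integral_rpow_mul_exp_eq ha 1 (f := fun u => c * u) (by fun_prop)
    rw [oscIntegral] at h
    push_cast at h h2
    rw [h] at h2
    have h3 := congrArg Complex.im h2
    simp at h3
    exact (integral_rpow_mul_sin_pos ha h1 hc).ne h3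
  · have h2 := integral_rpow_mul_exp_eq ha 1 (f := fun u => -(c * (1 - u))) (by fun_prop)
    have h3 : ∫ u in (0 : ℝ)..1, ((u ^ (a - 1) : ℝ) : ℂ) *
        Complex.exp (Complex.I * (-(c * (1 - u)) : ℝ)) =
        Complex.exp (-(Complex.I * c)) * oscIntegral a c := by
      rw [oscIntegral, ← intervalIntegral.integral_const_mul]
      refine intervalIntegral.integral_congr fun u _ => ?_
      rw [mul_left_comm, ← Complex.exp_add]
      push_cast
      ring_nf
    rw [h3, h, mul_zero] at h2
    have h4 := congrArg Complex.im h2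
    simp at h4
    exact (integral_rpow_mul_sin_one_sub_pos h1 hc).ne' h4

theorem genCi_add_genSi_mul_I {a θ : ℝ} (ha : 0 < a) (hθ : 0 ≤ θ) :
    (genCi a (a * θ) : ℂ) + genSi a (a * θ) * Complex.I =
      ((a * θ) ^ a : ℝ) * oscIntegral a (a * θ) := by
  have h := integral_rpow_mul_exp_eq ha (a * θ) (f := fun u => u) (by fun_prop)
  rw [genCi, genSi, ← h]
  rcases hθ.eq_or_lt with rfl | hθ
  · simp [Real.zero_rpow ha.ne']
  have hx : 0 < a * θ := mul_pos ha hθ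
  generalize a * θ = x at hx
  have hs := intervalIntegral.integral_comp_mul_left
    (fun u : ℝ => ((u ^ (a - 1) : ℝ) : ℂ) * Complex.exp (Complex.I * u)) hx.ne' (a := 0) (b := 1)
  rw [mul_zero, mul_one] at hs
  have hs' : ∫ u in (0 : ℝ)..x, ((u ^ (a - 1) : ℝ) : ℂ) * Complex.exp (Complex.I * u) =
      x • ∫ u in (0 : ℝ)..1,
        (((x * u) ^ (a - 1) : ℝ) : ℂ) * Complex.exp (Complex.I * (x * u : ℝ)) := by
    rw [hs, smul_inv_smul₀ hx.ne']
  rw [hs', oscIntegral, ← intervalIntegral.integral_smul, ← intervalIntegral.integral_const_mul]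
  refine intervalIntegral.integral_congr fun u hu => ?_
  rw [Set.uIcc_of_le zero_le_one] at hu
  rw [Real.mul_rpow hx.le hu.1, Complex.real_smul]
  have hxa : x ^ a = x * x ^ (a - 1) := by
    rw [mul_comm, ← Real.rpow_add_one hx.ne', sub_add_cancel]
  rw [hxa]
  push_cast
  ring

end Nonvanishing

/-! ### From the formal identity to the uniform expansion -/

section Asymptotics

open Polynomial

theorem norm_one_add_I_mul (x : ℝ) : ‖(1 : ℂ) + Complex.I * x‖ = Real.sqrt (1 + x ^ 2) := by
  have := Complex.norm_add_mul_I 1 x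
  rw [mul_comm]
  simpa using this

theorem norm_inv_one_add_I_mul_le_one (x : ℝ) : ‖((1 : ℂ) + Complex.I * x)⁻¹‖ ≤ 1 := by
  rw [norm_inv, norm_one_add_I_mul]
  exact inv_le_one_of_one_le₀ (Real.one_le_sqrt.mpr (by nlinarith [sq_nonneg x]))

/-- The source of uniformity in θ: one power of u trades |v(u)| for |v(1)|, which cancels the
prefactor 1 + iθ. -/
theorem mul_norm_inv_one_add_I_mul_le {u : ℝ} (hu : u ∈ Set.Icc (0 : ℝ) 1) (θ : ℝ) :
    u * ‖((1 : ℂ) + Complex.I * (u * θ : ℝ))⁻¹‖ ≤ ‖((1 : ℂ) + Complex.I * θ)⁻¹‖ := by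
  rw [norm_inv, norm_inv, norm_one_add_I_mul, norm_one_add_I_mul, ← div_eq_mul_inv,
    div_le_iff₀ (by positivity), inv_mul_eq_div, le_div_iff₀ (by positivity)]
  refine Real.le_sqrt_of_sq_le ?_
  rw [mul_pow, Real.sq_sqrt (by positivity)]
  nlinarith [hu.1, hu.2]

/-- The ratio of `Ci(a, aθ) + i Si(a, aθ)` to its leading approximation. -/
noncomputable def lgRatio (a θ : ℝ) : ℂ :=
  (1 + Complex.I * θ) * (a * Complex.exp (-(Complex.I * (a * θ : ℝ))) * oscIntegral a (a * θ))

/-- An approximate primitive of a u^(a-1) e^(iaθu); this computation dictates the form of Q. -/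
theorem hasDerivAt_lg_primitive (n : ℕ) {a : ℝ} (ha : 2 ≤ a) (θ : ℝ) {u : ℝ} (hu : 0 ≤ u) :
    HasDerivAt (fun u : ℝ => ((u ^ a : ℝ) : ℂ) * Complex.exp (Complex.I * ((a * θ : ℝ) * u)) *
        (Complex.exp ((lgL n).evalEval (1 + Complex.I * (u * θ : ℝ))⁻¹ (a : ℂ)⁻¹) *
          (1 + Complex.I * (u * θ : ℝ))⁻¹))
      (a * (((u ^ (a - 1) : ℝ) : ℂ) * Complex.exp (Complex.I * ((a * θ : ℝ) * u)) *
        (Complex.exp ((lgL n).evalEval (1 + Complex.I * (u * θ : ℝ))⁻¹ (a : ℂ)⁻¹) *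
          (lgQ n).evalEval (1 + Complex.I * (u * θ : ℝ))⁻¹ (a : ℂ)⁻¹))) u := by
  have hv : HasDerivAt (fun u : ℝ => ((1 : ℂ) + Complex.I * (u * θ : ℝ))⁻¹)
      (-(Complex.I * θ) * (1 + Complex.I * (u * θ : ℝ))⁻¹ ^ 2) u := by
    have h1 : HasDerivAt (fun u : ℝ => (1 : ℂ) + Complex.I * (u * θ : ℝ)) (Complex.I * θ) u := by
      have h := ((((hasDerivAt_id u).mul_const θ).ofReal_comp).const_mul Complex.I).const_add 1
      simpa using h
    refine (h1.fun_inv (one_add_I_mul_ne_zero _)).congr_deriv ?_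
    rw [inv_pow, div_eq_mul_inv]
  have hN := ((hasDerivAt_lgL n (1 + Complex.I * (u * θ : ℝ))⁻¹ (a : ℂ)⁻¹).comp u hv).cexp
  have he : HasDerivAt (fun u : ℝ => Complex.exp (Complex.I * ((a * θ : ℝ) * u)))
      (Complex.exp (Complex.I * ((a * θ : ℝ) * u)) * (Complex.I * (a * θ : ℝ))) u := by
    have h := ((Complex.ofRealCLM.hasDerivAt (x := u)).const_mul ((a * θ : ℝ) : ℂ)).const_mul
      Complex.I
    simp only [Complex.ofRealCLM_apply, Complex.ofReal_one, mul_one] at h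
    exact h.cexp
  have hp : HasDerivAt (fun u : ℝ => ((u ^ a : ℝ) : ℂ)) ((a * u ^ (a - 1) : ℝ) : ℂ) u :=
    (Real.hasDerivAt_rpow_const (Or.inr (by linarith))).ofReal_comp
  have hpow : u ^ a = u * u ^ (a - 1) := by
    rcases hu.eq_or_lt with rfl | hu
    · rw [Real.zero_rpow (by linarith), zero_mul]
    · rw [mul_comm, ← Real.rpow_add_one hu.ne', sub_add_cancel]
  refine ((hp.mul he).mul (hN.mul hv)).congr_deriv ?_
  have ha0 : (a : ℂ) ≠ 0 := by exact_mod_cast (by linarith : a ≠ 0)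
  simp only [Pi.mul_apply, Function.comp_apply]
  rw [evalEval_lgQ_eq, hpow]
  have hne := one_add_I_mul_ne_zero (u * θ)
  obtain ⟨w, hw⟩ : ∃ w : ℂ, w = 1 + Complex.I * (u * θ : ℝ) := ⟨_, rfl⟩
  rw [← hw] at hne ⊢
  have hθ : Complex.I * u * θ = w - 1 := by rw [hw]; push_cast; ring
  generalize evalEval w⁻¹ (a : ℂ)⁻¹ (lgL' n) = L'
  generalize Complex.exp (evalEval w⁻¹ (a : ℂ)⁻¹ (lgL n)) = N
  generalize Complex.exp (Complex.I * ((a * θ : ℝ) * u)) = E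
  generalize u ^ (a - 1) = P
  push_cast
  have : (w - 1) * (a : ℂ) * N * w⁻¹ - (w - 1) * L' * N * w⁻¹ ^ 3 - (w - 1) * N * w⁻¹ ^ 2 +
      a * N * w⁻¹ =
    a * N * (1 - (a : ℂ)⁻¹ * (w⁻¹ - w⁻¹ ^ 2) + (a : ℂ)⁻¹ * (w⁻¹ ^ 2 * (w⁻¹ - 1) * L')) := by
    field_simp
    ring
  rw [← hθ] at this
  linear_combination P * E * this

theorem exists_norm_exp_lgL_sub_lgRatio_le (n : ℕ) : ∃ C : ℝ, 0 ≤ C ∧ ∀ a θ : ℝ, 2 ≤ a →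
    ‖Complex.exp ((lgL n).evalEval (1 + Complex.I * θ)⁻¹ (a : ℂ)⁻¹) - lgRatio a θ‖ ≤
      C / a ^ n := by
  obtain ⟨C, hC, hb⟩ := exists_norm_defect_le n
  refine ⟨2 * C, by positivity, fun a θ ha => ?_⟩
  have ha0 : 0 < a := by linarith
  have hεn : ‖(a : ℂ)⁻¹‖ = a⁻¹ := by simp [ha0.le]
  have hε1 : ‖(a : ℂ)⁻¹‖ ≤ 1 := by rw [hεn]; exact inv_le_one_of_one_le₀ (by linarith)
  set v : ℝ → ℂ := fun u => (1 + Complex.I * (u * θ : ℝ))⁻¹ with hv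
  set G : ℝ → ℂ := fun u => Complex.exp ((lgL n).evalEval (v u) (a : ℂ)⁻¹) *
    (lgQ n).evalEval (v u) (a : ℂ)⁻¹ with hG
  set W : ℝ → ℂ := fun u => ((u ^ (a - 1) : ℝ) : ℂ) *
    Complex.exp (Complex.I * ((a * θ : ℝ) * u)) with hW
  have hvc : Continuous v :=
    Continuous.inv₀ (by fun_prop) fun u => one_add_I_mul_ne_zero _
  have hWc : Continuous W :=
    (Complex.continuous_ofReal.comp (Real.continuous_rpow_const (by linarith))).mul (by fun_prop)
  have hGc : Continuous G := by
    have h1 : Continuous fun x => (lgL n).evalEval x (a : ℂ)⁻¹ :=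
      continuous_iff_continuousAt.mpr fun x => (hasDerivAt_lgL n x _).continuousAt
    have h2 : Continuous fun x => (lgQ n).evalEval x (a : ℂ)⁻¹ :=
      continuous_iff_continuousAt.mpr fun x => (hasDerivAt_lgQ n x _).continuousAt
    exact (h1.comp hvc).cexp.mul (h2.comp hvc)
  have hWi := hWc.intervalIntegrable (μ := MeasureTheory.volume) 0 1
  have hWGi : IntervalIntegrable (fun u => W u * G u) MeasureTheory.volume 0 1 :=
    (hWc.mul hGc).intervalIntegrable 0 1
  have hftc : a * ∫ u in (0 : ℝ)..1, W u * G u =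
      Complex.exp (Complex.I * (a * θ : ℝ)) *
        (Complex.exp ((lgL n).evalEval (1 + Complex.I * θ)⁻¹ (a : ℂ)⁻¹) *
          (1 + Complex.I * θ)⁻¹) := by
    rw [← intervalIntegral.integral_const_mul]
    rw [intervalIntegral.integral_eq_sub_of_hasDerivAt
      (fun u hu => hasDerivAt_lg_primitive n ha θ (by
        rw [Set.uIcc_of_le zero_le_one] at hu; exact hu.1)) (hWGi.const_mul _)]
    simp [Real.zero_rpow ha0.ne']
  have hint : ‖∫ u in (0 : ℝ)..1, (W u * G u - W u)‖ ≤
      ∫ u in (0 : ℝ)..1, u ^ (a - 2) * (C * a⁻¹ ^ n * ‖((1 : ℂ) + Complex.I * θ)⁻¹‖) := by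
    refine intervalIntegral.norm_integral_le_of_norm_le zero_le_one
      (Filter.Eventually.of_forall fun u hu => ?_) ?_
    · have hvu : ‖v u‖ ≤ 1 := norm_inv_one_add_I_mul_le_one _
      have h1 := hb (v u) _ hvu hε1
      rw [hεn] at h1
      -- One factor u is split off to be absorbed by ‖v u‖.
      have hWn : ‖W u‖ = u ^ (a - 2) * u := by
        rw [hW, norm_mul, ← Complex.ofReal_mul, mul_comm Complex.I, Complex.norm_exp_ofReal_mul_I,
          mul_one, Complex.norm_real, Real.norm_of_nonneg (Real.rpow_nonneg hu.1.le _),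
          ← Real.rpow_add_one hu.1.ne']
        congr 1
        ring
      have h2 := mul_norm_inv_one_add_I_mul_le (Set.Ioc_subset_Icc_self hu) θ
      have h3 : 0 ≤ u ^ (a - 2) := Real.rpow_nonneg hu.1.le _
      rw [← mul_sub_one, norm_mul, hWn]
      calc u ^ (a - 2) * u * ‖G u - 1‖ ≤ u ^ (a - 2) * u * (C * a⁻¹ ^ n * ‖v u‖) := by
            have := hu.1.le
            gcongr
        _ = u ^ (a - 2) * (C * a⁻¹ ^ n * (u * ‖v u‖)) := by ring
        _ ≤ _ := by gcongr
    · exact ((Real.continuous_rpow_const (by linarith)).mul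
        continuous_const).intervalIntegrable _ _
  rw [intervalIntegral.integral_sub hWGi hWi, intervalIntegral.integral_mul_const,
    integral_rpow (Or.inl (by linarith)), Real.zero_rpow (by linarith), Real.one_rpow, sub_zero,
    show a - 2 + 1 = a - 1 by ring] at hint
  have hne := one_add_I_mul_ne_zero θ
  have hexp : Complex.exp (-(Complex.I * (a * θ : ℝ))) * Complex.exp (Complex.I * (a * θ : ℝ)) = 1 := by
    rw [← Complex.exp_add, neg_add_cancel, Complex.exp_zero]
  have hkey : Complex.exp ((lgL n).evalEval (1 + Complex.I * θ)⁻¹ (a : ℂ)⁻¹) - lgRatio a θ =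
      (1 + Complex.I * θ) * a * Complex.exp (-(Complex.I * (a * θ : ℝ))) *
        ((∫ u in (0 : ℝ)..1, W u * G u) - ∫ u in (0 : ℝ)..1, W u) := by
    have h1 : (∫ u in (0 : ℝ)..1, W u) = oscIntegral a (a * θ) := rfl
    rw [h1, lgRatio, mul_sub]
    have h2 : (1 + Complex.I * θ) * a * Complex.exp (-(Complex.I * (a * θ : ℝ))) *
        (∫ u in (0 : ℝ)..1, W u * G u) = (1 + Complex.I * θ) *
          Complex.exp (-(Complex.I * (a * θ : ℝ))) * (a * ∫ u in (0 : ℝ)..1, W u * G u) := by ring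
    rw [h2, hftc]
    generalize Complex.exp ((lgL n).evalEval (1 + Complex.I * θ)⁻¹ (a : ℂ)⁻¹) = N
    linear_combination (-N) * hexp - N * Complex.exp (-(Complex.I * (a * θ : ℝ))) *
      Complex.exp (Complex.I * (a * θ : ℝ)) * mul_inv_cancel₀ hne
  have hen : ‖Complex.exp (-(Complex.I * (a * θ : ℝ)))‖ = 1 := by
    rw [← mul_neg, mul_comm, ← Complex.ofReal_neg, Complex.norm_exp_ofReal_mul_I]
  rw [hkey, norm_mul, norm_mul, norm_mul, hen, mul_one, Complex.norm_real,
    Real.norm_of_nonneg ha0.le]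
  calc ‖(1 : ℂ) + Complex.I * θ‖ * a * ‖(∫ u in (0 : ℝ)..1, W u * G u) - ∫ u in (0 : ℝ)..1, W u‖
      ≤ ‖(1 : ℂ) + Complex.I * θ‖ * a *
        (1 / (a - 1) * (C * a⁻¹ ^ n * ‖((1 : ℂ) + Complex.I * θ)⁻¹‖)) := by gcongr
    _ = a / (a - 1) * (C / a ^ n) := by
        rw [norm_inv, inv_pow]
        have := norm_ne_zero_iff.mpr hne
        have : a - 1 ≠ 0 := by linarith
        field_simp
    -- The factor 1/(a-1) is ∫₀¹ u^(a-2) du, and a/(a-1) ≤ 2 for a ≥ 2.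
    _ ≤ 2 * (C / a ^ n) := by
        gcongr
        rw [div_le_iff₀ (by linarith)]
        linarith
    _ = 2 * C / a ^ n := by ring

theorem exists_norm_log_lgRatio_sub_le (n : ℕ) : ∃ C a₀ : ℝ, 0 < a₀ ∧ ∀ a θ : ℝ, a₀ ≤ a →
    ‖Complex.log (lgRatio a θ) - (lgL (n + 1)).evalEval (1 + Complex.I * θ)⁻¹ (a : ℂ)⁻¹‖ ≤
      C / a ^ (n + 1) := by
  obtain ⟨C, hC, hb⟩ := exists_norm_exp_lgL_sub_lgRatio_le (n + 1)
  obtain ⟨B, hB, hL⟩ := exists_norm_lgL_le (n + 1)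
  -- The three terms of the threshold give a ≥ 2, ‖l‖ ≤ 1 and ‖x‖ ≤ 1/2, where R = e^l (1 + x).
  refine ⟨3 / 2 * (Real.exp 1 * C), 2 + B + 2 * (Real.exp 1 * C), by positivity, fun a θ ha => ?_⟩
  have hEC : 0 ≤ Real.exp 1 * C := by positivity
  have ha2 : 2 ≤ a := by linarith
  have ha0 : 0 < a := by linarith
  have hεn : ‖(a : ℂ)⁻¹‖ = a⁻¹ := by simp [ha0.le]
  have hε1 : ‖(a : ℂ)⁻¹‖ ≤ 1 := by rw [hεn]; exact inv_le_one_of_one_le₀ (by linarith)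
  have h1 := hb a θ ha2
  have h2 := hL (1 + Complex.I * θ)⁻¹ (a : ℂ)⁻¹ (norm_inv_one_add_I_mul_le_one θ) hε1
  set l := (lgL (n + 1)).evalEval (1 + Complex.I * θ)⁻¹ (a : ℂ)⁻¹ with hl
  have hl1 : ‖l‖ ≤ 1 := by
    refine h2.trans ?_
    rw [hεn, ← div_eq_mul_inv, div_le_one ha0]
    linarith
  set x := Complex.exp (-l) * (lgRatio a θ - Complex.exp l) with hx
  have hxn : ‖x‖ ≤ Real.exp 1 * C / a ^ (n + 1) := by
    rw [hx, norm_mul, norm_sub_rev, mul_div_assoc]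
    gcongr
    refine (Complex.norm_exp_le_exp_norm _).trans (Real.exp_le_exp.mpr ?_)
    rwa [norm_neg]
  have hx2 : ‖x‖ ≤ 1 / 2 := by
    refine hxn.trans ?_
    rw [div_le_iff₀ (by positivity)]
    have : a ≤ a ^ (n + 1) := le_self_pow₀ (by linarith) (by omega)
    linarith
  have hlog := Complex.norm_log_one_add_half_le_self hx2
  have h1x : 1 + x = Complex.exp (-l) * lgRatio a θ := by
    rw [hx, mul_sub, ← Complex.exp_add, neg_add_cancel, Complex.exp_zero]
    ring
  have hx0 : 1 + x ≠ 0 := by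
    intro h
    have : ‖x‖ = 1 := by rw [show x = -1 by linear_combination h]; simp
    linarith
  have hR : lgRatio a θ = Complex.exp (l + Complex.log (1 + x)) := by
    rw [Complex.exp_add, Complex.exp_log hx0, h1x, ← mul_assoc, ← Complex.exp_add, add_neg_cancel,
      Complex.exp_zero, one_mul]
  -- Since 1 + 3/4 < π, the principal branch returns l + log(1 + x) with no multiple of 2πi.
  have him : |(l + Complex.log (1 + x)).im| ≤ 7 / 4 := by
    refine (Complex.abs_im_le_norm _).trans ((norm_add_le _ _).trans ?_)
    linarith
  have hpi := Real.pi_gt_three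
  rw [abs_le] at him
  rw [hR, Complex.log_exp (by linarith) (by linarith), add_sub_cancel_left]
  calc _ ≤ 3 / 2 * ‖x‖ := hlog
    _ ≤ 3 / 2 * (Real.exp 1 * C / a ^ (n + 1)) := by gcongr
    _ = _ := by ring

theorem evalEval_lgL_eq_sum_lgE (n : ℕ) (a θ : ℝ) :
    (lgL n).evalEval (1 + Complex.I * θ)⁻¹ (a : ℂ)⁻¹ =
      ∑ s ∈ Finset.Ico 1 n, (((-1) ^ s / a ^ s : ℝ) : ℂ) * lgE s (-(Complex.I * θ)) := by
  rw [lgL, evalEval_sum_monomial]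
  refine Finset.sum_congr rfl fun s hs => ?_
  rw [lgE_eq_eval_lgEPoly (Finset.mem_Ico.mp hs).1, eval_mul, eval_pow, eval_neg, eval_one]
  push_cast
  rw [inv_pow]
  ring

theorem exists_abs_re_im_log_lgRatio_sub_le (n : ℕ) : ∃ C a₀ : ℝ, 0 < a₀ ∧ ∀ a θ : ℝ, a₀ ≤ a →
    |(Complex.log (lgRatio a θ)).re - ∑ s ∈ Finset.Ico 1 n,
        (-1) ^ s * (lgE s (-(Complex.I * θ))).re / a ^ s| ≤ C / a ^ n ∧
    |(Complex.log (lgRatio a θ)).im - ∑ s ∈ Finset.Ico 1 n,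
        (-1) ^ s * (lgE s (-(Complex.I * θ))).im / a ^ s| ≤ C / a ^ n := by
  suffices h : ∃ C a₀ : ℝ, 0 < a₀ ∧ ∀ a θ : ℝ, a₀ ≤ a →
      ‖Complex.log (lgRatio a θ) - ∑ s ∈ Finset.Ico 1 n,
        (((-1) ^ s / a ^ s : ℝ) : ℂ) * lgE s (-(Complex.I * θ))‖ ≤ C / a ^ n by
    obtain ⟨C, a₀, h0, hb⟩ := h
    refine ⟨C, a₀, h0, fun a θ ha => ⟨?_, ?_⟩⟩
    · refine le_trans (le_of_eq ?_) ((Complex.abs_re_le_norm _).trans (hb a θ ha))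
      rw [Complex.sub_re, Complex.re_sum]
      simp only [Complex.re_ofReal_mul, div_mul_eq_mul_div]
    · refine le_trans (le_of_eq ?_) ((Complex.abs_im_le_norm _).trans (hb a θ ha))
      rw [Complex.sub_im, Complex.im_sum]
      simp only [Complex.im_ofReal_mul, div_mul_eq_mul_div]
  cases n with
  | succ n =>
    simp only [← evalEval_lgL_eq_sum_lgE]
    exact exists_norm_log_lgRatio_sub_le n
  -- Order 0 has the same empty sum as order 1, and follows from C/a ≤ |C| for a ≥ 1.
  | zero =>
    obtain ⟨C, a₀, h0, hb⟩ := exists_norm_log_lgRatio_sub_le 0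
    refine ⟨|C|, max a₀ 1, by positivity, fun a θ ha => ?_⟩
    have h := hb a θ ((le_max_left _ _).trans ha)
    have h1 : 1 ≤ a := (le_max_right _ _).trans ha
    rw [evalEval_lgL_eq_sum_lgE] at h
    simp only [zero_add, Finset.Ico_self, Finset.sum_empty, pow_one] at h
    simp only [Finset.Ico_eq_empty_of_le zero_le_one, Finset.sum_empty, pow_zero, div_one]
    refine h.trans ((div_le_div_of_nonneg_right (le_abs_self C) (by linarith)).trans ?_)
    exact div_le_self (abs_nonneg C) h1

theorem genCi_add_genSi_mul_I_eq_exp {a θ : ℝ} (ha : 0 < a) (ha1 : a ≠ 1) (hθ : 0 ≤ θ) :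
    (genCi a (a * θ) : ℂ) + genSi a (a * θ) * Complex.I =
      ((a * θ) ^ a * Real.exp (Complex.log (lgRatio a θ)).re / (a * Real.sqrt (θ ^ 2 + 1)) : ℝ) *
        Complex.exp (Complex.I *
          (a * θ - Real.arctan θ + (Complex.log (lgRatio a θ)).im : ℝ)) := by
  rw [genCi_add_genSi_mul_I ha hθ]
  have ha0 : (a : ℂ) ≠ 0 := by exact_mod_cast ha.ne'
  have hne := one_add_I_mul_ne_zero θ
  have hR : lgRatio a θ ≠ 0 := mul_ne_zero hne (mul_ne_zero (mul_ne_zero ha0 (Complex.exp_ne_zero _))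
    (oscIntegral_ne_zero ha ha1 (mul_nonneg ha.le hθ)))
  have hs : 0 < Real.sqrt (θ ^ 2 + 1) := by positivity
  have hs0 : (Real.sqrt (θ ^ 2 + 1) : ℂ) ≠ 0 := by exact_mod_cast hs.ne'
  have harc : Complex.exp (Complex.I * Real.arctan θ) * Real.sqrt (θ ^ 2 + 1) =
      1 + Complex.I * θ := by
    rw [exp_I_mul_ofReal, Real.cos_arctan, Real.sin_arctan, add_comm 1 (θ ^ 2)]
    push_cast
    field_simp
  have hlog : Complex.exp (Complex.log (lgRatio a θ)).re *
      Complex.exp (Complex.I * (Complex.log (lgRatio a θ)).im) = lgRatio a θ := by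
    rw [← Complex.exp_add, mul_comm Complex.I, Complex.re_add_im, Complex.exp_log hR]
  have hsplit : Complex.exp (Complex.I *
      (a * θ - Real.arctan θ + (Complex.log (lgRatio a θ)).im : ℝ)) *
      Complex.exp (Complex.I * Real.arctan θ) =
      Complex.exp (Complex.I * (a * θ : ℝ)) *
        Complex.exp (Complex.I * (Complex.log (lgRatio a θ)).im) := by
    rw [← Complex.exp_add, ← Complex.exp_add]
    congr 1
    push_cast
    ring
  have hexp : Complex.exp (-(Complex.I * (a * θ : ℝ))) * Complex.exp (Complex.I * (a * θ : ℝ)) =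
      1 := by
    rw [← Complex.exp_add, neg_add_cancel, Complex.exp_zero]
  have hM : Complex.exp (Complex.log (lgRatio a θ)).re * Complex.exp (Complex.I *
      (a * θ - Real.arctan θ + (Complex.log (lgRatio a θ)).im : ℝ)) =
      a * Real.sqrt (θ ^ 2 + 1) * oscIntegral a (a * θ) := by
    refine mul_right_cancel₀ (Complex.exp_ne_zero (Complex.I * Real.arctan θ)) ?_
    rw [mul_assoc, hsplit, mul_left_comm, hlog, lgRatio, ← harc]
    linear_combination (Complex.exp (Complex.I * Real.arctan θ) * Real.sqrt (θ ^ 2 + 1) * a *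
      oscIntegral a (a * θ)) * hexp
  rw [Complex.ofReal_div, Complex.ofReal_mul, Complex.ofReal_exp, Complex.ofReal_mul, div_mul_eq_mul_div,
    mul_assoc, hM]
  field_simp

end Asymptotics

theorem mainTheorem2 :
    ∃ ER EI : ℝ → ℝ → ℝ,
      (∀ a θ : ℝ, 0 < a → a ≠ 1 → 0 ≤ θ →
        genCi a (a * θ) =
            (a * θ) ^ a * Real.exp (ER a θ) / (a * Real.sqrt (θ ^ 2 + 1)) *
              Real.cos (a * θ - Real.arctan θ + EI a θ) ∧
        genSi a (a * θ) =
            (a * θ) ^ a * Real.exp (ER a θ) / (a * Real.sqrt (θ ^ 2 + 1)) *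
              Real.sin (a * θ - Real.arctan θ + EI a θ) ∧
        ∀ α : ℝ, genTi a (a * θ) α =
            (a * θ) ^ a * Real.exp (ER a θ) / (a * Real.sqrt (θ ^ 2 + 1)) *
              Real.cos (a * θ - Real.arctan θ - α * Real.pi + EI a θ)) ∧
      (∀ n : ℕ, ∃ C a₀ : ℝ, 0 < a₀ ∧ ∀ a θ : ℝ, a₀ ≤ a → 0 ≤ θ →
        |ER a θ - ∑ s ∈ Finset.Ico 1 n,
            (-1) ^ s * (lgE s (-(Complex.I * θ))).re / a ^ s| ≤ C / a ^ n ∧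
        |EI a θ - ∑ s ∈ Finset.Ico 1 n,
            (-1) ^ s * (lgE s (-(Complex.I * θ))).im / a ^ s| ≤ C / a ^ n) := by
  -- Any branch of the logarithm would serve the exact formulas; the principal one is the branch
  -- tending to 0 as a → ∞.
  refine ⟨fun a θ => (Complex.log (lgRatio a θ)).re, fun a θ => (Complex.log (lgRatio a θ)).im,
    fun a θ ha ha1 hθ => ?_, fun n => ?_⟩
  · have h := genCi_add_genSi_mul_I_eq_exp ha ha1 hθ
    rw [exp_I_mul_ofReal] at h
    have hre := congrArg Complex.re h
    have him := congrArg Complex.im h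
    rw [Complex.re_ofReal_mul] at hre
    rw [Complex.im_ofReal_mul] at him
    simp only [Complex.add_re, Complex.add_im, Complex.ofReal_re, Complex.ofReal_im,
      Complex.re_ofReal_mul, Complex.im_ofReal_mul, Complex.I_re, Complex.I_im, mul_zero, mul_one,
      add_zero, zero_add] at hre him
    refine ⟨hre, him, fun α => ?_⟩
    rw [genTi, hre, him, show a * θ - Real.arctan θ - α * Real.pi + (Complex.log (lgRatio a θ)).im =
      (a * θ - Real.arctan θ + (Complex.log (lgRatio a θ)).im) - Real.pi * α by ring, Real.cos_sub]
    ring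
  · obtain ⟨C, a₀, h0, hb⟩ := exists_abs_re_im_log_lgRatio_sub_le n
    exact ⟨C, a₀, h0, fun a θ ha _ => hb a θ ha⟩
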